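/- Let $d$ be a positive integer, let $\lambda>0$, and let $L$ be a homogeneous Poisson point process of intensity $\lambda$ on $\mathbb{R}^d$, that is, a random subset of $\mathbb{R}^d$ such that the number of points of $L$ in any Borel set $B$ of finite volume has the Poisson distribution with mean $\lambda\,\mathrm{vol}(B)$, and the numbers of points of $L$ in pairwise disjoint such sets are independent. Friendly frogs on a set $L\subseteq\mathbb{R}^d$ is the following two-player game. Alice places a frog on a point of $L$; then Bob places a second frog on a different point of $L$. Thereafter the players alternate, starting with Alice; a move consists of moving one of the two frogs (either one) to a point of $L$ not occupied by the other frog in such a way that the Euclidean distance between the two frogs strictly decreases. A player who cannot move loses and the other player wins. A strategy for a player is a map that assigns a legal move (if one exists) to each position, where a position consists of the locations of $0$, $1$ or $2$ frogs. The game is a win for Bob if Bob has a strategy such that, whatever strategy Alice uses, the game ends after finitely many moves with Bob winning. A matching of $L$ is a set of unordered pairs of distinct points of $L$ such that each point of $L$ is in at most one pair; it is perfect if each point is in exactly one pair. It is stable if there are no two distinct points $x,y\in L$ such that each of $x$ and $y$ is either unmatched or has a partner at distance strictly greater than $|x-y|$. Theorem. With probability $1$, friendly frogs on $L$ is a win for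 Bob. Moreover, with probability $1$, $L$ has exactly one stable matching, and this stable matching is perfect. -/

import Mathlib

open MeasureTheory ProbabilityTheory
open scoped NNReal

/-! ## Poisson point processes -/

/-- The random set `L` is a homogeneous Poisson point process of intensity `lam` on `ℝ^d`:
the number of points of `L` in a Borel set of finite volume has the Poisson distribution with mean
`lam` times the volume, and the numbers of points in finitely many pairwise disjoint such sets are
independent. (Numbers of points take values in `ℕ∞`; the law makes them finite almost surely.) -/
structure IsPoissonPointProcess {d : ℕ} {Ω : Type*} [MeasurableSpace Ω]
    (L : Ω → Set (EuclideanSpace ℝ (Fin d))) (lam : ℝ≥0) (μ : Measure Ω) : Prop where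
  hasLaw_count : ∀ B : Set (EuclideanSpace ℝ (Fin d)), MeasurableSet B → volume B < ⊤ →
    HasLaw (fun ω => (L ω ∩ B).encard)
      ((poissonMeasure (lam * (volume B).toNNReal)).map (Nat.cast : ℕ → ℕ∞)) μ
  iIndepFun_count : ∀ (n : ℕ) (B : Fin n → Set (EuclideanSpace ℝ (Fin d))),
    (∀ i, MeasurableSet (B i)) → (∀ i, volume (B i) < ⊤) → Pairwise (fun i j => Disjoint (B i) (B j)) →
    iIndepFun (fun (i : Fin n) (ω : Ω) => (L ω ∩ B i).encard) μ

/-! ## The game of friendly frogs on a set `L` of lily pads -/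

/-- A position: the locations of 0, 1 or 2 (indistinguishable) frogs on lily pads of `L`. -/
inductive FrogPosition {E : Type*} (L : Set E) : Type _
  | noFrog : FrogPosition L
  | oneFrog (x : L) : FrogPosition L
  | twoFrogs (p : Sym2 L) : FrogPosition L

/-- The legal moves. The first two moves place the frogs on distinct pads; after that one frog (at
`y`) jumps to a pad `z` not occupied by the other frog (at `x`), strictly decreasing the distance
between the frogs. As pairs are unordered, either frog may be the one to jump. -/
inductive FrogMove {E : Type*} [MetricSpace E] (L : Set E) :
    FrogPosition L → FrogPosition L → Prop
  | placeFirst (x : L) : FrogMove L .noFrog (.oneFrog x)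
  | placeSecond (x y : L) (hne : y ≠ x) : FrogMove L (.oneFrog x) (.twoFrogs s(x, y))
  | jump (x y z : L) (hne : z ≠ x) (hlt : dist x z < dist x y) :
      FrogMove L (.twoFrogs s(x, y)) (.twoFrogs s(x, z))

/-- No legal move is available. -/
def FrogTerminal {E : Type*} [MetricSpace E] (L : Set E) (p : FrogPosition L) : Prop :=
  ∀ q, ¬ FrogMove L p q

/-- A strategy assigns a legal move, if one exists, to each position (the value at terminal
positions is irrelevant). -/
def IsFrogStrategy {E : Type*} [MetricSpace E] (L : Set E)
    (σ : FrogPosition L → FrogPosition L) : Prop :=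
  ∀ p, ¬ FrogTerminal L p → FrogMove L p (σ p)

/-- The successive positions when Alice uses `a` and Bob uses `b`: Alice is to move at even times,
Bob at odd times. The sequence is meaningful up to the first terminal position. -/
def frogPlay {E : Type*} {L : Set E} (a b : FrogPosition L → FrogPosition L) :
    ℕ → FrogPosition L
  | 0 => .noFrog
  | n + 1 => if Even n then a (frogPlay a b n) else b (frogPlay a b n)

/-- Playing `a` (Alice) against `b` (Bob) results in a win for Bob: the play reaches a terminal
position, and at the first such position it is Alice's turn. -/
def BobWinsPlay {E : Type*} [MetricSpace E] (L : Set E)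
    (a b : FrogPosition L → FrogPosition L) : Prop :=
  ∃ n, Even n ∧ FrogTerminal L (frogPlay a b n) ∧ ∀ m < n, ¬ FrogTerminal L (frogPlay a b m)

/-- Friendly frogs on `L` is a win for Bob: he has a strategy that results in a win for him
whatever strategy Alice uses. -/
def FriendlyFrogsWinForBob {E : Type*} [MetricSpace E] (L : Set E) : Prop :=
  ∃ b, IsFrogStrategy L b ∧ ∀ a, IsFrogStrategy L a → BobWinsPlay L a b

/-! ## Stable matchings -/

/-- `M` is a matching of `L`: a set of unordered pairs of distinct points of `L` such that each
point of `L` is in at most one pair. -/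
def IsFrogMatching {E : Type*} (L : Set E) (M : Set (Sym2 L)) : Prop :=
  (∀ e ∈ M, ¬ e.IsDiag) ∧ ∀ x : L, ∀ e ∈ M, ∀ f ∈ M, x ∈ e → x ∈ f → e = f

/-- Each point of `L` is in exactly one pair of `M`. -/
def IsPerfectFrogMatching {E : Type*} (L : Set E) (M : Set (Sym2 L)) : Prop :=
  IsFrogMatching L M ∧ ∀ x : L, ∃! e, e ∈ M ∧ x ∈ e

/-- `x` strictly prefers `y` to its own partner in `M`; this holds when `x` is unmatched. -/
def StrictlyPrefers {E : Type*} [MetricSpace E] {L : Set E} (M : Set (Sym2 L)) (x y : L) : Prop :=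
  ∀ z : L, s(x, z) ∈ M → dist x y < dist x z

/-- A matching without unstable pairs, i.e. pairs of distinct points that strictly prefer each other
over their own partners. -/
def IsStableFrogMatching {E : Type*} [MetricSpace E] (L : Set E) (M : Set (Sym2 L)) : Prop :=
  IsFrogMatching L M ∧ ∀ x y : L, x ≠ y → ¬ (StrictlyPrefers M x y ∧ StrictlyPrefers M y x)

/-! ## Stable matchings and friendly frogs on a fixed set -/

section Deterministic

variable {E : Type*} [MetricSpace E] {L : Set E}

/-! Fix a set of pads. Call a set `M` of pairs a kernel if a pair of distinct points lies in `M`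
exactly when no jump from it leads into `M`. If there is no infinite chain of jumps, well-founded
recursion gives exactly one kernel (`exists_isFrogKernel`, `IsFrogKernel.unique`); if distances from
a point are never tied, kernels are the same as stable matchings
(`isStableFrogMatching_iff_isFrogKernel`). If the kernel covers every point, Bob wins: he answers
Alice's first frog at its partner, every jump of Alice leaves `M`, and he can jump back into it.

For a Poisson process three facts therefore remain. Ties are null by a first moment bound
(`measure_exists_injective_le`). Infinite chains are excluded by subcritical percolation: their
distances converge to some `l`, so they eventually run through points linked at distances in a thin
shell around `l`, and the expected number of long self-avoiding paths with such steps tends to zero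
(`wellFounded_frogRel`, `ae_wellFounded_frogRel`). Finally, a stable matching leaves at most one
point unmatched; by translation invariance that point would be equally likely to lie in each of
infinitely many disjoint unit cubes, which is impossible on a probability space
(`ae_not_greedyUnmatched`).

The last argument needs measurability and equality of laws, although only the laws of counts are
given. So it works with the field of occupied dyadic cubes: counts determine its law
(`map_occupancy_eq`), it determines the points (`occupiedPoints_occupancy`), and the kernel is a
limit of the explicit stages `greedyPair`. -/

/-- `f` can be reached from `e` by one jump. -/
def FrogRel (L : Set E) (f e : Sym2 L) : Prop := FrogMove L (.twoFrogs e) (.twoFrogs f)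

/-- Any two distinct pads are at different distances from a third one. -/
def NoIsosceles (L : Set E) : Prop :=
  ∀ x ∈ L, ∀ y ∈ L, ∀ z ∈ L, x ≠ y → x ≠ z → y ≠ z → dist x y ≠ dist x z

/-- Balls contain finitely many points of `L`. -/
def IsLocallyFiniteSet (L : Set E) : Prop :=
  ∀ (x : E) (r : ℝ), (L ∩ Metric.closedBall x r).Finite

theorem frogRel_mk_left {x y z : L} (hne : z ≠ x) (hlt : dist x z < dist x y) :
    FrogRel L s(x, z) s(x, y) := FrogMove.jump x y z hne hlt

theorem frogRel_mk_right {x y z : L} (hne : z ≠ y) (hlt : dist y z < dist x y) :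
    FrogRel L s(y, z) s(x, y) := by
  rw [Sym2.eq_swap (a := x)]
  exact FrogMove.jump y x z hne (by rwa [dist_comm y x])

theorem frogRel_mk_iff {x y : L} {f : Sym2 L} :
    FrogRel L f s(x, y) ↔ (∃ z, z ≠ x ∧ dist x z < dist x y ∧ f = s(x, z)) ∨
      ∃ z, z ≠ y ∧ dist y z < dist x y ∧ f = s(y, z) := by
  constructor
  · intro h
    unfold FrogRel at h
    generalize hp : FrogPosition.twoFrogs s(x, y) = p at h
    generalize hq : FrogPosition.twoFrogs f = q at h
    cases h with
    | placeFirst x => cases hp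
    | placeSecond x y hne => cases hp
    | jump a b c hne hlt =>
      have h1 := FrogPosition.twoFrogs.inj hp
      have h2 := FrogPosition.twoFrogs.inj hq
      subst h2
      rcases Sym2.eq_iff.1 h1 with ⟨rfl, rfl⟩ | ⟨rfl, rfl⟩
      · exact Or.inl ⟨c, hne, hlt, rfl⟩
      · exact Or.inr ⟨c, hne, by rwa [dist_comm x y], rfl⟩
  · rintro (⟨z, h1, h2, rfl⟩ | ⟨z, h1, h2, rfl⟩)
    · exact frogRel_mk_left h1 h2
    · exact frogRel_mk_right h1 h2

theorem FrogRel.not_isDiag {f e : Sym2 L} (h : FrogRel L f e) : ¬ f.IsDiag := by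
  induction e with
  | _ x y =>
    rcases frogRel_mk_iff.1 h with ⟨z, h1, -, rfl⟩ | ⟨z, h1, -, rfl⟩ <;>
      simpa using h1.symm

/-- Among the pairs of distinct points, exactly those without an adjacent closer pair in `M`
belong to `M`. -/
def IsFrogKernel (L : Set E) (M : Set (Sym2 L)) : Prop :=
  ∀ e, e ∈ M ↔ ¬ e.IsDiag ∧ ∀ f, FrogRel L f e → f ∉ M

theorem exists_isFrogKernel (hwf : WellFounded (FrogRel L)) : ∃ M, IsFrogKernel L M := by
  let K : Sym2 L → Prop := hwf.fix fun e ih => ¬ e.IsDiag ∧ ∀ f (h : FrogRel L f e), ¬ ih f h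
  refine ⟨{e | K e}, fun e => ?_⟩
  change K e ↔ _
  rw [show K e = _ from hwf.fix_eq _ e]
  rfl

theorem IsFrogKernel.unique (hwf : WellFounded (FrogRel L)) {M M' : Set (Sym2 L)}
    (h : IsFrogKernel L M) (h' : IsFrogKernel L M') : M = M' := by
  ext e
  induction e using hwf.induction with
  | _ e ih =>
    rw [h e, h' e]
    exact and_congr_right fun _ => forall_congr' fun f => forall_congr' fun hf =>
      not_congr (ih f hf)

/-- For a pair outside `M`, a point fails to prefer the other strictly only if its own partner is at
most as far away, hence strictly closer since ties are excluded; moving the other frog to that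
partner is then a jump into `M`. -/
theorem isStableFrogMatching_iff_isFrogKernel (hiso : NoIsosceles L) {M : Set (Sym2 L)} :
    IsStableFrogMatching L M ↔ IsFrogKernel L M := by
  constructor
  · rintro ⟨⟨hd, hm⟩, hs⟩ e
    induction e with
    | _ x y =>
      constructor
      · intro he
        refine ⟨hd _ he, fun f hf hfM => ?_⟩
        rcases frogRel_mk_iff.1 hf with ⟨z, -, h2, rfl⟩ | ⟨z, -, h2, rfl⟩
        · have := hm x _ he _ hfM (by simp) (by simp)
          rcases Sym2.eq_iff.1 this with ⟨-, rfl⟩ | ⟨rfl, rfl⟩ <;> exact absurd h2 (lt_irrefl _)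
        · have := hm y _ he _ hfM (by simp) (by simp)
          rcases Sym2.eq_iff.1 this with ⟨rfl, rfl⟩ | ⟨rfl, -⟩
          · exact absurd h2 (lt_irrefl _)
          · rw [dist_comm] at h2
            exact absurd h2 (lt_irrefl _)
      · rintro ⟨hne, hf⟩
        by_contra he
        have key : ∀ a b : L, a ≠ b → s(a, b) ∉ M → (∀ f, FrogRel L f s(a, b) → f ∉ M) →
            StrictlyPrefers M a b := by
          intro a b hab habM hfab z hz
          by_contra hlt
          have haz : a ≠ z := by
            rintro rfl
            exact hd _ hz (by simp)
          have hzb : z ≠ b := by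
            rintro rfl
            exact habM hz
          have := hiso a a.2 z z.2 b b.2 (by simpa [Subtype.ext_iff] using haz)
            (by simpa [Subtype.ext_iff] using hab) (by simpa [Subtype.ext_iff] using hzb)
          have hlt' : dist a z < dist a b := lt_of_le_of_ne (not_lt.1 hlt) this
          exact hfab _ (frogRel_mk_left haz.symm hlt') hz
        have hxy : x ≠ y := by simpa using hne
        refine hs x y hxy ⟨key x y hxy he hf, key y x hxy.symm ?_ ?_⟩
        · rwa [Sym2.eq_swap]
        · rwa [Sym2.eq_swap]
  · intro h
    have hd : ∀ e ∈ M, ¬ e.IsDiag := fun e he => ((h e).1 he).1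
    refine ⟨⟨hd, fun x e he f hf hxe hxf => ?_⟩, fun x y hxy hp => ?_⟩
    · obtain ⟨y, rfl⟩ := Sym2.mem_iff_exists.1 hxe
      obtain ⟨z, rfl⟩ := Sym2.mem_iff_exists.1 hxf
      have hxy : x ≠ y := by simpa using hd _ he
      have hxz : x ≠ z := by simpa using hd _ hf
      by_contra hne
      have hyz : y ≠ z := by
        rintro rfl
        exact hne rfl
      have := hiso x x.2 y y.2 z z.2 (by simpa [Subtype.ext_iff] using hxy)
        (by simpa [Subtype.ext_iff] using hxz) (by simpa [Subtype.ext_iff] using hyz)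
      rcases lt_or_gt_of_ne this with hlt | hlt
      · exact ((h _).1 hf).2 _ (frogRel_mk_left hxy.symm hlt) he
      · exact ((h _).1 he).2 _ (frogRel_mk_left hxz.symm hlt) hf
    · by_cases he : s(x, y) ∈ M
      · exact lt_irrefl _ (hp.1 y he)
      · have := mt (h s(x, y)).2 he
        push Not at this
        obtain ⟨f, hf, hfM⟩ := this (by simpa using hxy)
        rcases frogRel_mk_iff.1 hf with ⟨z, -, h2, rfl⟩ | ⟨z, -, h2, rfl⟩
        · exact lt_asymm h2 (hp.1 z hfM)
        · have := hp.2 z hfM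
          rw [dist_comm y x] at this
          exact lt_asymm h2 this

theorem existsUnique_isStableFrogMatching (hiso : NoIsosceles L)
    (hwf : WellFounded (FrogRel L)) : ∃! M, IsStableFrogMatching L M := by
  obtain ⟨M, hM⟩ := exists_isFrogKernel hwf
  refine ⟨M, (isStableFrogMatching_iff_isFrogKernel hiso).2 hM, fun M' hM' => ?_⟩
  exact IsFrogKernel.unique hwf ((isStableFrogMatching_iff_isFrogKernel hiso).1 hM') hM

/-- A stable matching leaves at most one point unmatched. -/
theorem IsStableFrogMatching.unmatched_unique {M : Set (Sym2 L)} (hM : IsStableFrogMatching L M)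
    {x y : L} (hx : ∀ z, s(x, z) ∉ M) (hy : ∀ z, s(y, z) ∉ M) : x = y := by
  by_contra hne
  exact hM.2 x y hne ⟨fun z hz => absurd hz (hx z), fun z hz => absurd hz (hy z)⟩

theorem IsFrogMatching.isPerfect {E : Type*} {L : Set E} {M : Set (Sym2 L)} (hM : IsFrogMatching L M)
    (h : ∀ x : L, ∃ y, s(x, y) ∈ M) : IsPerfectFrogMatching L M := by
  refine ⟨hM, fun x => ?_⟩
  obtain ⟨y, hy⟩ := h x
  exact ⟨s(x, y), ⟨hy, by simp⟩, fun e he => hM.2 x e he.1 _ hy he.2 (by simp)⟩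

open Classical in
/-- If the unique stable matching is perfect then Bob wins by always occupying one of its pairs. -/
theorem friendlyFrogsWinForBob_of_isFrogKernel (hwf : WellFounded (FrogRel L))
    {M : Set (Sym2 L)} (hM : IsFrogKernel L M) (hperf : ∀ x : L, ∃ y, s(x, y) ∈ M) :
    FriendlyFrogsWinForBob L := by
  -- the positions from which the player who has just moved wins
  let G : FrogPosition L → Prop := fun p => ∃ e ∈ M, p = .twoFrogs e
  -- Bob enters `G` when he can. The other branches only make `b` a total strategy: an arbitrary
  -- legal move, or `p` itself at a terminal position.
  let b : FrogPosition L → FrogPosition L := fun p =>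
    if h : ∃ q, FrogMove L p q ∧ G q then h.choose
    else if h : ∃ q, FrogMove L p q then h.choose else p
  have hb1 : ∀ p, (∃ q, FrogMove L p q ∧ G q) → FrogMove L p (b p) ∧ G (b p) := by
    intro p hp
    simp only [b, dif_pos hp]
    exact hp.choose_spec
  refine ⟨b, fun p hp => ?_, fun a ha => ?_⟩
  · by_cases h : ∃ q, FrogMove L p q ∧ G q
    · exact (hb1 p h).1
    · have h' : ∃ q, FrogMove L p q := by simpa [FrogTerminal] using hp
      simp only [b, dif_neg h, dif_pos h']
      exact h'.choose_spec
  · -- after a move of Alice from a pair of `M`, Bob can return to `M`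
    have answer : ∀ e ∈ M, ∀ q, FrogMove L (.twoFrogs e) q →
        ∃ f ∈ M, ∃ g, q = .twoFrogs g ∧ FrogRel L g e ∧ b q = .twoFrogs f ∧ FrogRel L f g := by
      intro e he q hq
      obtain ⟨g, rfl⟩ : ∃ g, q = .twoFrogs g := by
        cases hq with
        | jump x y z hne hlt => exact ⟨_, rfl⟩
      have hg : FrogRel L g e := hq
      have hgM : g ∉ M := ((hM e).1 he).2 g hg
      have : ∃ f, FrogRel L f g ∧ f ∈ M := by
        by_contra hcon
        push Not at hcon
        exact hgM ((hM g).2 ⟨hg.not_isDiag, hcon⟩)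
      obtain ⟨f, hfg, hfM⟩ := this
      obtain ⟨h1, f', hf', h2⟩ := hb1 (.twoFrogs g) ⟨.twoFrogs f, hfg, f, hfM, rfl⟩
      refine ⟨f', hf', g, rfl, hg, h2, ?_⟩
      rw [h2] at h1
      exact h1
    have step : ∀ e ∈ M, ∀ n, Even n → frogPlay a b n = .twoFrogs e →
        (∀ m < n, ¬ FrogTerminal L (frogPlay a b m)) → BobWinsPlay L a b := by
      intro e
      -- A round consists of two jumps, so the pair in `M` descends along the transitive closure.
      induction e using hwf.transGen.induction with
      | _ e ih =>
        intro he n hn hpl hm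
        by_cases ht : FrogTerminal L (frogPlay a b n)
        · exact ⟨n, hn, ht, hm⟩
        · have h1 : FrogMove L (.twoFrogs e) (frogPlay a b (n + 1)) := by
            have := ha _ ht
            simpa [frogPlay, hn, hpl] using this
          obtain ⟨f, hf, g, hg, hge, hbf, hfg⟩ := answer e he _ h1
          have h2 : frogPlay a b (n + 2) = .twoFrogs f := by
            rw [← hbf]
            have : ¬ Even (n + 1) := by simpa [Nat.even_add_one] using hn
            rw [show n + 2 = (n + 1) + 1 from rfl, frogPlay, if_neg this]
          refine ih f (Relation.TransGen.head hfg (.single hge)) hf (n + 2)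
            (by simpa [Nat.even_add] using hn) h2 ?_
          intro m hm'
          rcases Nat.lt_succ_iff_lt_or_eq.1 hm' with hm' | rfl
          · rcases Nat.lt_succ_iff_lt_or_eq.1 hm' with hm' | rfl
            · exact hm m hm'
            · exact ht
          · rw [hg]
            intro hter
            exact hter _ hfg
    -- With no pads at all Alice loses at once.
    by_cases h0 : FrogTerminal L (.noFrog)
    · exact ⟨0, Even.zero, h0, by simp⟩
    · have h1 := ha _ h0
      obtain ⟨x, hx⟩ : ∃ x, a .noFrog = .oneFrog x := by
        generalize a .noFrog = q at h1
        cases h1 with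
        | placeFirst x => exact ⟨x, rfl⟩
      have hxne : ∀ y, s(x, y) ∈ M → y ≠ x := by
        rintro y hy rfl
        exact ((hM _).1 hy).1 (by simp)
      obtain ⟨y, hy⟩ := hperf x
      obtain ⟨h2, e, he, h3⟩ := hb1 (.oneFrog x)
        ⟨.twoFrogs s(x, y), .placeSecond x y (hxne y hy), _, hy, rfl⟩
      refine step e he 2 (by decide) ?_ ?_
      · rw [← h3, ← hx]
        simp [frogPlay]
      · intro m hm
        interval_cases m
        · simpa [frogPlay] using h0
        · have : frogPlay a b 1 = .oneFrog x := by simp [frogPlay, hx]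
          rw [this]
          intro hter
          exact hter _ h2

/-! ### The stable matching as a limit of explicit stages. -/

/-- Approximations to the stable matching: at each stage keep the pairs without adjacent closer
pairs in the previous stage. -/
def greedyPair (L : Set E) : ℕ → E → E → Prop
  | 0, _, _ => True
  | n + 1, x, y => ∀ z ∈ L, (z ≠ x → dist x z < dist x y → ¬ greedyPair L n x z) ∧
      (z ≠ y → dist y z < dist x y → ¬ greedyPair L n y z)

/-- The pair is eventually kept. -/
def GreedyMatched (L : Set E) (x y : E) : Prop := ∃ N, ∀ n ≥ N, greedyPair L n x y

/-- `x` is a point of `L` without partner. -/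
def GreedyUnmatched (L : Set E) (x : E) : Prop :=
  x ∈ L ∧ ∀ y ∈ L, y ≠ x → ¬ GreedyMatched L x y

/-- Only finitely many jumps are available from a pair, so by well-founded induction all the pairs
they reach have stabilised from some stage on, and the pair itself has stabilised one stage later.
-/
theorem eventually_greedyPair_iff (hfin : IsLocallyFiniteSet L) (hwf : WellFounded (FrogRel L))
    {M : Set (Sym2 L)} (hM : IsFrogKernel L M) (e : Sym2 L) :
    ∀ x y : L, s(x, y) = e → x ≠ y → ∀ᶠ n in Filter.atTop, (greedyPair L n x y ↔ e ∈ M) := by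
  induction e using hwf.induction with
  | _ e ih =>
    rintro x y rfl hxy
    have hev : ∀ a b : L, (∀ z : L, z ≠ a → dist a z < dist x y → FrogRel L s(a, z) s(x, y)) →
        ∀ᶠ n in Filter.atTop, ∀ z ∈ {z : L | z ≠ a ∧ dist a z < dist x y},
          (greedyPair L n a z ↔ s(a, z) ∈ M) := by
      intro a b hab
      have hf : {z : L | z ≠ a ∧ dist a z < dist x y}.Finite := by
        refine Set.Finite.of_finite_image (f := Subtype.val) ?_ Subtype.val_injective.injOn
        refine (hfin a (dist x y)).subset ?_
        rintro _ ⟨z, hz, rfl⟩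
        refine ⟨z.2, ?_⟩
        rw [Metric.mem_closedBall, dist_comm]
        exact hz.2.le
      rw [Filter.eventually_all_finite hf]
      intro z hz
      exact ih _ (hab z hz.1 hz.2) a z rfl hz.1.symm
    have h1 := hev x y fun z h h' => frogRel_mk_left h h'
    have h2 := hev y x fun z h h' => frogRel_mk_right h h'
    obtain ⟨N, hN⟩ := Filter.eventually_atTop.1 (h1.and h2)
    refine Filter.eventually_atTop.2 ⟨N + 1, fun n hn => ?_⟩
    obtain ⟨m, rfl⟩ : ∃ m, n = m + 1 := ⟨n - 1, by omega⟩
    obtain ⟨h1, h2⟩ := hN m (by omega)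
    rw [hM s(x, y)]
    constructor
    · intro hg
      refine ⟨by simpa using hxy, fun f hf hfM => ?_⟩
      rcases frogRel_mk_iff.1 hf with ⟨z, hz, hlt, rfl⟩ | ⟨z, hz, hlt, rfl⟩
      · exact (hg z z.2).1 (by simpa [Subtype.ext_iff] using hz) hlt ((h1 z ⟨hz, hlt⟩).2 hfM)
      · exact (hg z z.2).2 (by simpa [Subtype.ext_iff] using hz) hlt ((h2 z ⟨hz, hlt⟩).2 hfM)
    · rintro ⟨-, hf⟩ z hz
      constructor
      · intro hne hlt hg
        have hne' : (⟨z, hz⟩ : L) ≠ x := by simpa [Subtype.ext_iff] using hne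
        exact hf _ (frogRel_mk_left hne' hlt) ((h1 ⟨z, hz⟩ ⟨hne', hlt⟩).1 hg)
      · intro hne hlt hg
        have hne' : (⟨z, hz⟩ : L) ≠ y := by simpa [Subtype.ext_iff] using hne
        exact hf _ (frogRel_mk_right hne' hlt) ((h2 ⟨z, hz⟩ ⟨hne', hlt⟩).1 hg)

theorem greedyMatched_iff (hfin : IsLocallyFiniteSet L) (hwf : WellFounded (FrogRel L))
    {M : Set (Sym2 L)} (hM : IsFrogKernel L M) {x y : L} (hxy : x ≠ y) :
    GreedyMatched L x y ↔ s(x, y) ∈ M := by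
  have h := eventually_greedyPair_iff hfin hwf hM s(x, y) x y rfl hxy
  constructor
  · intro hg
    obtain ⟨n, h1, h2⟩ := (h.and (Filter.eventually_atTop.2 hg)).exists
    exact h1.1 h2
  · intro hm
    exact Filter.eventually_atTop.1 (h.mono fun n hn => hn.2 hm)

theorem greedyUnmatched_iff (hfin : IsLocallyFiniteSet L) (hwf : WellFounded (FrogRel L))
    {M : Set (Sym2 L)} (hM : IsFrogKernel L M) {x : L} :
    GreedyUnmatched L x ↔ ∀ y, s(x, y) ∉ M := by
  constructor
  · rintro ⟨-, h⟩ y hy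
    have hne : x ≠ y := by simpa using ((hM _).1 hy).1
    exact h y y.2 (by simpa [Subtype.ext_iff] using hne.symm)
      ((greedyMatched_iff hfin hwf hM hne).2 hy)
  · refine fun h => ⟨x.2, fun y hy hne hg => h ⟨y, hy⟩ ?_⟩
    exact (greedyMatched_iff hfin hwf hM (x := x) (y := ⟨y, hy⟩)
      (by simpa [Subtype.ext_iff] using hne.symm)).1 hg

end Deterministic

/-! ## Dyadic cubes -/

section Dyadic

variable {d : ℕ}

/-- The index of the dyadic cube of side `2⁻ᵏ` that contains `x`. -/
noncomputable def dyadicIndex (k : ℕ) (x : EuclideanSpace ℝ (Fin d)) : Fin d → ℤ :=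
  fun m => ⌊2 ^ k * x m⌋

/-- The half-open dyadic cube of side `2⁻ᵏ` with index `a`. -/
def dyadicCube (k : ℕ) (a : Fin d → ℤ) : Set (EuclideanSpace ℝ (Fin d)) :=
  {x | dyadicIndex k x = a}

theorem mem_dyadicCube_iff {k : ℕ} {a : Fin d → ℤ} {x : EuclideanSpace ℝ (Fin d)} :
    x ∈ dyadicCube k a ↔ dyadicIndex k x = a := Iff.rfl

theorem mem_dyadicCube_iff_Ico {k : ℕ} {a : Fin d → ℤ} {x : EuclideanSpace ℝ (Fin d)} :
    x ∈ dyadicCube k a ↔ ∀ m, x m ∈ Set.Ico ((a m : ℝ) / 2 ^ k) ((a m + 1) / 2 ^ k) := by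
  rw [mem_dyadicCube_iff, funext_iff]
  refine forall_congr' fun m => ?_
  have h2 : (0 : ℝ) < 2 ^ k := by positivity
  rw [dyadicIndex, Int.floor_eq_iff, Set.mem_Ico, div_le_iff₀ h2, lt_div_iff₀ h2, mul_comm]

theorem measurable_dyadicIndex (k : ℕ) :
    Measurable (dyadicIndex k : EuclideanSpace ℝ (Fin d) → Fin d → ℤ) := by
  refine measurable_pi_lambda _ fun m => Int.measurable_floor.comp ?_
  fun_prop

theorem measurableSet_dyadicCube (k : ℕ) (a : Fin d → ℤ) : MeasurableSet (dyadicCube k a) :=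
  measurable_dyadicIndex k (MeasurableSet.singleton a)

theorem disjoint_dyadicCube {k : ℕ} {a b : Fin d → ℤ} (hab : a ≠ b) :
    Disjoint (dyadicCube k a) (dyadicCube k b) :=
  Set.disjoint_left.2 fun _ ha hb => hab (ha.symm.trans hb)

theorem volume_dyadicCube (k : ℕ) (a : Fin d → ℤ) :
    volume (dyadicCube k a) = ((((1 / 2) ^ k) ^ d : ℝ≥0) : ENNReal) := by
  have h : dyadicCube k a = (WithLp.ofLp : EuclideanSpace ℝ (Fin d) → Fin d → ℝ) ⁻¹'
      (Set.univ.pi fun m => Set.Ico ((a m : ℝ) / 2 ^ k) ((a m + 1) / 2 ^ k)) := by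
    ext x
    rw [mem_dyadicCube_iff_Ico]
    simp
  rw [h, (PiLp.volume_preserving_ofLp (Fin d)).measure_preimage
    (MeasurableSet.univ_pi fun m => measurableSet_Ico).nullMeasurableSet, volume_pi_pi]
  have : ∀ m, volume (Set.Ico ((a m : ℝ) / 2 ^ k) ((a m + 1) / 2 ^ k)) =
      (((1 / 2) ^ k : ℝ≥0) : ENNReal) := by
    intro m
    rw [Real.volume_Ico, ← sub_div, add_sub_cancel_left, ENNReal.ofReal,
      ENNReal.coe_inj]
    ext
    simp
  rw [Finset.prod_congr rfl fun m _ => this m, Finset.prod_const, Finset.card_univ,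
    Fintype.card_fin, ← ENNReal.coe_pow]

theorem volume_dyadicCube_lt_top (k : ℕ) (a : Fin d → ℤ) : volume (dyadicCube k a) < ⊤ := by
  rw [volume_dyadicCube]
  exact ENNReal.coe_lt_top

theorem dist_le_of_dyadicIndex_eq {k : ℕ} {x y : EuclideanSpace ℝ (Fin d)}
    (h : dyadicIndex k x = dyadicIndex k y) : dist x y ≤ √d * (1 / 2) ^ k := by
  have hc : ∀ m, dist (x m) (y m) ≤ (1 / 2) ^ k := by
    intro m
    have hx := mem_dyadicCube_iff_Ico.1 (mem_dyadicCube_iff.2 h) m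
    have hy := mem_dyadicCube_iff_Ico.1 (mem_dyadicCube_iff.2 (rfl : dyadicIndex k y = _)) m
    rw [Real.dist_eq, abs_le, one_div, inv_pow, ← one_div]
    rw [add_div] at hx hy
    constructor <;> linarith [hx.1, hx.2, hy.1, hy.2]
  rw [EuclideanSpace.dist_eq]
  refine Real.sqrt_le_iff.2 ⟨by positivity, ?_⟩
  calc ∑ m, dist (x m) (y m) ^ 2 ≤ ∑ _m : Fin d, ((1 / 2 : ℝ) ^ k) ^ 2 :=
        Finset.sum_le_sum fun m _ => pow_le_pow_left₀ dist_nonneg (hc m) 2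
    _ = (√d * (1 / 2) ^ k) ^ 2 := by
        rw [mul_pow, Real.sq_sqrt (Nat.cast_nonneg d)]
        simp

theorem tendsto_sqrt_mul_half_pow (d : ℕ) :
    Filter.Tendsto (fun k : ℕ => √d * (1 / 2 : ℝ) ^ k) Filter.atTop (nhds 0) := by
  simpa using (tendsto_pow_atTop_nhds_zero_of_lt_one (r := (1 / 2 : ℝ)) (by norm_num)
    (by norm_num)).const_mul (√d)

theorem eventually_dyadicIndex_ne {x y : EuclideanSpace ℝ (Fin d)} (h : x ≠ y) :
    ∀ᶠ k in Filter.atTop, dyadicIndex k x ≠ dyadicIndex k y := by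
  filter_upwards [(tendsto_sqrt_mul_half_pow d).eventually_lt_const (dist_pos.2 h)] with k hk heq
  exact absurd (dist_le_of_dyadicIndex_eq heq) (not_le.2 hk)

/-- The index of the cube of level `k` that contains the cube with index `b` of level `k + j`. -/
def dyadicAncestor (j : ℕ) (b : Fin d → ℤ) : Fin d → ℤ := fun m => b m / 2 ^ j

theorem dyadicIndex_eq_ancestor (k j : ℕ) (x : EuclideanSpace ℝ (Fin d)) :
    dyadicIndex k x = dyadicAncestor j (dyadicIndex (k + j) x) := by
  funext m
  have h : (2 : ℝ) ^ k * x m = (2 ^ (k + j) * x m) / ((2 ^ j : ℕ) : ℝ) := by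
    push_cast
    field_simp
    ring
  simp only [dyadicIndex, dyadicAncestor]
  rw [h, Int.floor_div_natCast]
  push_cast
  rfl

end Dyadic

/-! ## The first moment method for Poisson processes -/

section FirstMoment

variable {d : ℕ} {Ω : Type*} [MeasurableSpace Ω] {μ : Measure Ω} {lam : ℝ≥0}
  {L : Ω → Set (EuclideanSpace ℝ (Fin d))}

theorem poissonMeasure_compl_zero_le (r : ℝ≥0) : poissonMeasure r {0}ᶜ ≤ r := by
  rw [prob_compl_eq_one_sub (MeasurableSet.singleton 0), poissonMeasure_singleton]
  rw [tsub_le_iff_left, ← ENNReal.ofReal_coe_nnreal, ← ENNReal.ofReal_add (by positivity)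
    (by positivity), ← ENNReal.ofReal_one]
  refine ENNReal.ofReal_le_ofReal ?_
  have := Real.add_one_le_exp (-(r : ℝ))
  simp
  linarith

theorem IsPoissonPointProcess.measure_encard_mem (hL : IsPoissonPointProcess L lam μ)
    {B : Set (EuclideanSpace ℝ (Fin d))} (hB : MeasurableSet B) (hv : volume B < ⊤)
    {s : Set ℕ∞} (hs : MeasurableSet s) :
    μ {ω | (L ω ∩ B).encard ∈ s} =
      poissonMeasure (lam * (volume B).toNNReal) {n | (n : ℕ∞) ∈ s} := by
  have h := hL.hasLaw_count B hB hv
  have h1 : μ ((fun ω => (L ω ∩ B).encard) ⁻¹' s) = _ :=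
    (Measure.map_apply_of_aemeasurable h.aemeasurable hs).symm
  rw [h.map_eq, Measure.map_apply .of_discrete hs] at h1
  exact h1

theorem IsPoissonPointProcess.measure_nonempty_le (hL : IsPoissonPointProcess L lam μ)
    {B : Set (EuclideanSpace ℝ (Fin d))} (hB : MeasurableSet B) (hv : volume B < ⊤) :
    μ {ω | (L ω ∩ B).Nonempty} ≤ lam * volume B := by
  have h := hL.measure_encard_mem hB hv (MeasurableSet.singleton (0 : ℕ∞)).compl
  simp only [Set.mem_compl_iff, Set.mem_singleton_iff, Set.encard_eq_zero,
    ← ne_eq, ← Set.nonempty_iff_ne_empty] at h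
  rw [h]
  calc _ = poissonMeasure (lam * (volume B).toNNReal) {0}ᶜ := by
        congr 1
        ext n
        simp
    _ ≤ _ := poissonMeasure_compl_zero_le _
    _ = lam * volume B := by
        rw [ENNReal.coe_mul, ENNReal.coe_toNNReal hv.ne]

/-- Disjointness turns the joint event into a product by independence; each factor is at most the
mean count. -/
theorem IsPoissonPointProcess.measure_forall_nonempty_le (hL : IsPoissonPointProcess L lam μ)
    {m : ℕ} {B : Fin m → Set (EuclideanSpace ℝ (Fin d))} (hB : ∀ i, MeasurableSet (B i))
    (hv : ∀ i, volume (B i) < ⊤) (hd : Pairwise fun i j => Disjoint (B i) (B j)) :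
    μ {ω | ∀ i, (L ω ∩ B i).Nonempty} ≤ lam ^ m * ∏ i, volume (B i) := by
  have h := (hL.iIndepFun_count m B hB hv hd).meas_iInter
    (s := fun i => {ω | (L ω ∩ B i).Nonempty}) (fun i => ⟨{0}ᶜ,
      (MeasurableSet.singleton 0).compl, by
        ext ω
        simp [Set.nonempty_iff_ne_empty]⟩)
  rw [Set.ofPred_forall, h]
  calc ∏ i, μ {ω | (L ω ∩ B i).Nonempty} ≤ ∏ i, (lam * volume (B i)) :=
        Finset.prod_le_prod' fun i _ => hL.measure_nonempty_le (hB i) (hv i)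
    _ = _ := by simp [Finset.prod_mul_distrib]

/-- The probability that some tuple of distinct points of a Poisson process lies in a compact set
is at most the expected number of such tuples. -/
theorem IsPoissonPointProcess.measure_exists_injective_le (hL : IsPoissonPointProcess L lam μ)
    {m : ℕ} {P : Set (Fin m → EuclideanSpace ℝ (Fin d))} (hP : IsCompact P) :
    μ {ω | ∃ v ∈ P, Function.Injective v ∧ ∀ i, v i ∈ L ω} ≤ lam ^ m * volume P := by
  let S : ℕ → Set (Fin m → Fin d → ℤ) := fun k =>
    {a | Function.Injective a ∧ ∃ v ∈ P, ∀ i, v i ∈ dyadicCube k (a i)}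
  let A : ℕ → Set Ω := fun k => ⋃ a ∈ S k, {ω | ∀ i, (L ω ∩ dyadicCube k (a i)).Nonempty}
  -- Union bound over tuples of distinct cubes: their products are disjoint boxes meeting `P`, so
  -- they fit inside a thickening of `P` by the diameter bound of a cube.
  have hA : ∀ k, μ (A k) ≤ lam ^ m * volume (Metric.cthickening (√d * (1 / 2) ^ k) P) := by
    intro k
    calc μ (A k) ≤ ∑' a : S k, μ {ω | ∀ i, (L ω ∩ dyadicCube k (a.1 i)).Nonempty} :=
          measure_biUnion_le μ (Set.to_countable _) _
      _ ≤ ∑' a : S k, lam ^ m * volume (Set.univ.pi fun i => dyadicCube k (a.1 i)) := by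
          refine ENNReal.tsum_le_tsum fun a => ?_
          rw [volume_pi_pi]
          exact hL.measure_forall_nonempty_le (fun i => measurableSet_dyadicCube k _)
            (fun i => volume_dyadicCube_lt_top k _)
            fun i j hij => disjoint_dyadicCube (a.2.1.ne hij)
      _ = lam ^ m * volume (⋃ a : S k, Set.univ.pi fun i => dyadicCube k (a.1 i)) := by
          rw [ENNReal.tsum_mul_left, measure_iUnion]
          · intro a b hab
            refine Set.disjoint_left.2 fun v hva hvb => hab ?_
            ext1
            funext i
            exact (hva i trivial).symm.trans (hvb i trivial)
          · exact fun a => MeasurableSet.univ_pi fun i => measurableSet_dyadicCube k _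
      _ ≤ _ := by
          gcongr
          refine Set.iUnion_subset fun a w hw => ?_
          obtain ⟨v, hvP, hv⟩ := a.2.2
          refine Metric.mem_cthickening_of_dist_le w v _ P hvP ?_
          exact (dist_pi_le_iff (by positivity)).2 fun i =>
            dist_le_of_dyadicIndex_eq ((hw i trivial).trans (hv i).symm)
  have hlim : Filter.Tendsto
      (fun k : ℕ => (lam : ENNReal) ^ m * volume (Metric.cthickening (√d * (1 / 2) ^ k) P))
      Filter.atTop (nhds (lam ^ m * volume P)) := by
    refine ENNReal.Tendsto.const_mul ?_ (Or.inr (by finiteness))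
    exact (tendsto_measure_cthickening_of_isCompact hP).comp (tendsto_sqrt_mul_half_pow d)
  -- Distinct points are separated by all sufficiently fine cubes, so the event lies in the lower
  -- limit of the `A k`. No measurability is needed for the resulting bound.
  have hsub : {ω | ∃ v ∈ P, Function.Injective v ∧ ∀ i, v i ∈ L ω} ⊆
      ⋃ K : ℕ, ⋂ k ≥ K, A k := by
    rintro ω ⟨v, hvP, hinj, hvL⟩
    have hev : ∀ᶠ k in Filter.atTop, Function.Injective fun i => dyadicIndex k (v i) := by
      have : ∀ᶠ k in Filter.atTop, ∀ i j, i ≠ j → dyadicIndex k (v i) ≠ dyadicIndex k (v j) := by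
        simp only [Filter.eventually_all]
        exact fun i j hij => eventually_dyadicIndex_ne (hinj.ne hij)
      filter_upwards [this] with k hk i j hij
      by_contra hne
      exact hk i j hne hij
    obtain ⟨K, hK⟩ := Filter.eventually_atTop.1 hev
    refine Set.mem_iUnion.2 ⟨K, Set.mem_iInter₂.2 fun k hk => Set.mem_iUnion₂.2
      ⟨fun i => dyadicIndex k (v i), ⟨hK k hk, v, hvP, fun i => rfl⟩, fun i => ?_⟩⟩
    exact ⟨v i, hvL i, rfl⟩
  refine (measure_mono hsub).trans ?_
  rw [Monotone.measure_iUnion]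
  · refine iSup_le fun K => ?_
    refine ge_of_tendsto' (hlim.comp (Filter.tendsto_add_atTop_nat K)) fun k => ?_
    exact (measure_mono (Set.iInter₂_subset (k + K) (Nat.le_add_left K k))).trans (hA _)
  · intro K K' hKK'
    exact Set.biInter_subset_biInter_left fun k hk => le_trans hKK' hk

end FirstMoment

/-! ## Absence of infinite descending chains -/

section Shells

variable {E : Type*} [MetricSpace E]

/-- Tuples that start in a ball and whose steps have lengths between `q₁` and `q₂`. -/
def shellPaths (c : E) (R q₁ q₂ : ℝ) (n : ℕ) : Set (Fin (n + 1) → E) :=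
  {v | v 0 ∈ Metric.closedBall c R ∧
    ∀ i : Fin n, dist (v i.castSucc) (v i.succ) ∈ Set.Icc q₁ q₂}

theorem isCompact_shellPaths [ProperSpace E] (c : E) (R q₁ q₂ : ℝ) (n : ℕ) :
    IsCompact (shellPaths c R q₁ q₂ n) := by
  refine IsCompact.of_isClosed_subset
    (isCompact_univ_pi fun i : Fin (n + 1) => isCompact_closedBall c (R + i * q₂)) ?_ ?_
  · have h0 : Continuous fun v : Fin (n + 1) → E => v 0 := continuous_apply 0
    have h1 : ∀ i : Fin n, Continuous fun v : Fin (n + 1) → E =>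
        dist (v i.castSucc) (v i.succ) := fun i => by fun_prop
    have : shellPaths c R q₁ q₂ n = (fun v : Fin (n + 1) → E => v 0) ⁻¹' Metric.closedBall c R ∩
        ⋂ i : Fin n, (fun v : Fin (n + 1) → E => dist (v i.castSucc) (v i.succ)) ⁻¹'
          Set.Icc q₁ q₂ := by
      ext v
      simp [shellPaths]
    rw [this]
    exact (Metric.isClosed_closedBall.preimage h0).inter
      (isClosed_iInter fun i => isClosed_Icc.preimage (h1 i))
  · rintro v ⟨h0, hv⟩ i -
    induction i using Fin.induction with
    | zero => simpa using h0
    | succ i ih =>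
      rw [Metric.mem_closedBall] at ih ⊢
      have h1 := (hv i).2
      rw [dist_comm] at h1
      have h2 := dist_triangle (v i.succ) (v i.castSucc) c
      simp at ih ⊢
      linarith

/-- Along an infinite chain the distances decrease to a limit `l`. Consecutive pairs share a point,
so from some time on all pairs lie in one component of the graph of distances in `[q₁, q₂]`. Bounded
self-avoiding paths make this component finite, whereas the pairs of the chain are all distinct. -/
theorem wellFounded_frogRel {L : Set E} (hfin : IsLocallyFiniteSet L)
    (hL : ∀ l : ℝ, ∃ q₁ q₂, q₁ < l ∧ l < q₂ ∧ ∀ x ∈ L, ∃ n : ℕ,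
      ¬ ∃ v ∈ shellPaths x 0 q₁ q₂ n, Function.Injective v ∧ ∀ i, v i ∈ L) :
    WellFounded (FrogRel L) := by
  rw [wellFounded_iff_isEmpty_descending_chain]
  refine ⟨fun ⟨e, he⟩ => ?_⟩
  let D : Sym2 L → ℝ := Sym2.lift ⟨fun x y => dist x y, dist_comm⟩
  have hD0 : ∀ e, 0 ≤ D e := fun e => by
    induction e with
    | _ x y => exact dist_nonneg
  have hDlt : ∀ n, D (e (n + 1)) < D (e n) := by
    intro n
    have h := he n
    generalize e (n + 1) = f at h
    generalize e n = g at h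
    induction g with
    | _ x y =>
      rcases frogRel_mk_iff.1 h with ⟨z, -, h2, rfl⟩ | ⟨z, -, h2, rfl⟩ <;> exact h2
  have hanti : StrictAnti fun n => D (e n) := strictAnti_nat_of_succ_lt hDlt
  have hlim := tendsto_atTop_ciInf hanti.antitone
    ⟨0, by rintro _ ⟨n, rfl⟩; exact hD0 _⟩
  obtain ⟨q₁, q₂, h1, h2, hpath⟩ := hL (⨅ n, D (e n))
  obtain ⟨N, hN⟩ := Filter.eventually_atTop.1 (hlim.eventually (Ioo_mem_nhds h1 h2))
  let G : SimpleGraph L :=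
    { Adj := fun x y => x ≠ y ∧ dist x y ∈ Set.Icc q₁ q₂
      symm := ⟨fun x y h => ⟨h.1.symm, by rw [dist_comm]; exact h.2⟩⟩
      loopless := ⟨fun x h => h.1 rfl⟩ }
  have hadj : ∀ n ≥ N, ∀ x y, e (n + 1) = s(x, y) → G.Adj x y := by
    intro n hn x y hxy
    have hd := (he n).not_isDiag
    rw [hxy] at hd
    have := hN (n + 1) (by omega)
    rw [hxy] at this
    exact ⟨by simpa using hd, this.1.le, this.2.le⟩
  obtain ⟨x₀, hx₀⟩ : ∃ x, x ∈ e (N + 1) := by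
    induction e (N + 1) with
    | _ x y => exact ⟨x, by simp⟩
  have hreach : ∀ n ≥ N, ∀ y ∈ e (n + 1), G.Reachable x₀ y := by
    intro n hn
    induction n, hn using Nat.le_induction with
    | base =>
      intro y hy
      obtain ⟨z, hz⟩ := Sym2.mem_iff_exists.1 hx₀
      rw [hz, Sym2.mem_iff] at hy
      rcases hy with rfl | rfl
      · exact SimpleGraph.Reachable.refl _
      · exact (hadj N le_rfl _ _ hz).reachable
    | succ n hn ih =>
      obtain ⟨x, y, hxy⟩ : ∃ x y, e (n + 1) = s(x, y) := by
        induction e (n + 1) with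
        | _ x y => exact ⟨x, y, rfl⟩
      have key : ∀ a b, a ∈ e (n + 1) → e (n + 1 + 1) = s(a, b) →
          ∀ c ∈ e (n + 1 + 1), G.Reachable x₀ c := by
        intro a b ha hab c hc
        rw [hab, Sym2.mem_iff] at hc
        rcases hc with rfl | rfl
        · exact ih _ ha
        · exact (ih _ ha).trans (hadj (n + 1) (by omega) _ _ hab).reachable
      have h := he (n + 1)
      rw [hxy] at h
      rcases frogRel_mk_iff.1 h with ⟨z, -, -, h2⟩ | ⟨z, -, -, h2⟩
      · exact key x z (by simp [hxy]) h2
      · exact key y z (by simp [hxy]) h2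
  obtain ⟨n, hn⟩ := hpath x₀ x₀.2
  have hcl : {y | G.Reachable x₀ y}.Finite := by
    refine Set.Finite.of_finite_image (f := Subtype.val) ?_ Subtype.val_injective.injOn
    refine (hfin x₀ (n * max q₂ 0)).subset ?_
    rintro _ ⟨y, ⟨w⟩, rfl⟩
    classical
    refine ⟨y.2, ?_⟩
    obtain ⟨p, hp⟩ := w.toPath
    -- The first `n` steps of a longer simple path would form a shell path excluded by `hn`.
    have hlen : p.length < n := by
      by_contra hge
      refine hn ⟨fun i => p.getVert i, ⟨by simp, fun i => ?_⟩, fun i j hij => ?_, fun i => ?_⟩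
      · have := p.adj_getVert_succ (i := i) (by omega)
        exact this.2
      · have := hp.getVert_injOn (by simp; omega) (by simp; omega) (Subtype.ext hij)
        exact Fin.ext this
      · exact Subtype.coe_prop _
    have hdist : ∀ (a b : L) (q : G.Walk a b), dist a b ≤ q.length * max q₂ 0 := by
      intro a b q
      induction q with
      | nil => simp
      | cons h q ih =>
        rename_i u v w
        have h1 := dist_triangle u v w
        have h2 : dist u v ≤ max q₂ 0 := h.2.2.trans (le_max_left _ _)
        simp only [SimpleGraph.Walk.length_cons]
        push_cast
        linarith
    rw [Metric.mem_closedBall, dist_comm]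
    refine (hdist _ _ p).trans ?_
    gcongr
  have hfinE : {f : Sym2 L | ∀ y ∈ f, G.Reachable x₀ y}.Finite := by
    refine ((hcl.prod hcl).image fun p => s(p.1, p.2)).subset fun f hf => ?_
    induction f with
    | _ x y => exact ⟨(x, y), ⟨hf x (by simp), hf y (by simp)⟩, rfl⟩
  refine Set.infinite_of_injective_forall_mem (f := fun n => e (N + n + 1)) ?_ ?_ hfinE
  · intro a b hab
    have := hanti.injective (congrArg D hab)
    omega
  · exact fun n => hreach (N + n) (by omega)

end Shells

/-! ### Volumes of shells and almost sure properties of Poisson processes. -/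

section AlmostSure

variable {d : ℕ} {Ω : Type*} [MeasurableSpace Ω] {μ : Measure Ω} {lam : ℝ≥0}
  {L : Ω → Set (EuclideanSpace ℝ (Fin d))}

/-- Fubini in the last coordinate. It serves both for shell paths, one step at a time, and for ties,
where the fibres are null. -/
theorem volume_pi_le_of_snoc {E : Type*} [MeasureSpace E] [SigmaFinite (volume : Measure E)]
    {n : ℕ} {P : Set (Fin (n + 1) → E)} (hP : MeasurableSet P) {Q : Set (Fin n → E)}
    (f : (Fin n → E) → Set E) {θ : ENNReal} (hf : ∀ w, volume (f w) ≤ θ)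
    (h : ∀ v ∈ P, Fin.init v ∈ Q ∧ v (Fin.last n) ∈ f (Fin.init v)) :
    volume P ≤ θ * volume Q := by
  have hmp := (volume_preserving_piFinSuccAbove (fun _ : Fin (n + 1) => E) (Fin.last n)).symm
  rw [← hmp.measure_preimage hP.nullMeasurableSet, Measure.volume_eq_prod,
    Measure.prod_apply_symm (hmp.measurable hP)]
  refine le_trans (lintegral_mono fun w => ?_) (lintegral_indicator_const_le Q θ)
  have key : ∀ y : E, (MeasurableEquiv.piFinSuccAbove (fun _ => E) (Fin.last n)).symm (y, w) ∈ P →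
      w ∈ Q ∧ y ∈ f w := by
    intro y hy
    have := h _ hy
    simpa [MeasurableEquiv.piFinSuccAbove, Fin.insertNthEquiv] using this
  by_cases hw : w ∈ Q
  · rw [Set.indicator_of_mem hw]
    exact (measure_mono fun y hy => (key y hy).2).trans (hf w)
  · rw [Set.indicator_of_notMem hw, nonpos_iff_eq_zero]
    refine measure_mono_null (fun y hy => ?_) measure_empty
    exact hw (key y hy).1

theorem volume_shell_eq (x : EuclideanSpace ℝ (Fin d)) (q₁ q₂ : ℝ) :
    volume {y | dist x y ∈ Set.Icc q₁ q₂} =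
      volume {y : EuclideanSpace ℝ (Fin d) | ‖y‖ ∈ Set.Icc q₁ q₂} := by
  rw [← measure_preimage_add_right volume (-x)
    {y : EuclideanSpace ℝ (Fin d) | ‖y‖ ∈ Set.Icc q₁ q₂}]
  congr 1
  ext y
  rw [Set.mem_ofPred_eq, dist_comm, dist_eq_norm, sub_eq_add_neg]
  rfl

/-- The closed shells around radius `l` decrease to a sphere, which is null in positive dimension.
Rational radii leave only countably many shells to treat, although `l` will depend on the
realisation. -/
theorem exists_rat_shell_volume_le (hd : 0 < d) (l : ℝ) {η : ENNReal} (hη : 0 < η) :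
    ∃ q₁ q₂ : ℚ, (q₁ : ℝ) < l ∧ l < q₂ ∧
      volume {y : EuclideanSpace ℝ (Fin d) | ‖y‖ ∈ Set.Icc (q₁ : ℝ) q₂} ≤ η := by
  have : Nonempty (Fin d) := ⟨⟨0, hd⟩⟩
  let s : ℝ → Set (EuclideanSpace ℝ (Fin d)) := fun δ => {y | |‖y‖ - l| ≤ δ}
  have hs : ⋂ δ > 0, s δ = Metric.sphere 0 l := by
    ext y
    simp only [s, Set.mem_iInter, Set.mem_ofPred_eq, mem_sphere_zero_iff_norm]
    constructor
    · intro h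
      have := le_of_forall_gt_imp_ge_of_dense h
      rw [abs_nonpos_iff] at this
      linarith
    · rintro h δ hδ
      rw [h]
      simpa using hδ.le
  have hlim := tendsto_measure_biInter_gt (μ := volume) (s := s) (a := 0)
    (fun r _ => (measurableSet_le (by fun_prop) (by fun_prop)).nullMeasurableSet)
    (fun i j _ hij y hy => le_trans hy hij) ⟨1, one_pos, by
      refine ((measure_mono ?_).trans_lt
        (measure_closedBall_lt_top (x := (0 : EuclideanSpace ℝ (Fin d))) (r := l + 1))).ne
      intro y hy
      have := (abs_le.1 (show |‖y‖ - l| ≤ 1 from hy)).2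
      rw [mem_closedBall_zero_iff]
      linarith⟩
  rw [hs, Measure.addHaar_sphere] at hlim
  obtain ⟨δ, hδ, hδ0⟩ := ((hlim.eventually (gt_mem_nhds hη)).and self_mem_nhdsWithin).exists
  replace hδ0 : 0 < δ := hδ0
  obtain ⟨q₁, h1, h1'⟩ := exists_rat_btwn (show l - δ < l by linarith)
  obtain ⟨q₂, h2, h2'⟩ := exists_rat_btwn (show l < l + δ by linarith)
  refine ⟨q₁, q₂, h1', h2, (measure_mono ?_).trans hδ.le⟩
  rintro y ⟨hy1, hy2⟩
  change |‖y‖ - l| ≤ δ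
  rw [abs_le]
  constructor <;> linarith

theorem volume_shellPaths_le (c : EuclideanSpace ℝ (Fin d)) (R q₁ q₂ : ℝ) (n : ℕ) :
    volume (shellPaths c R q₁ q₂ n) ≤
      volume {y : EuclideanSpace ℝ (Fin d) | ‖y‖ ∈ Set.Icc q₁ q₂} ^ n *
        volume (Metric.closedBall c R) := by
  induction n with
  | zero =>
    refine (volume_pi_le_of_snoc (isCompact_shellPaths c R q₁ q₂ 0).measurableSet
      (Q := Set.univ) (fun _ => Metric.closedBall c R) (fun _ => le_rfl) ?_).trans ?_
    · exact fun v hv => ⟨trivial, hv.1⟩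
    · have : volume (Set.univ : Set (Fin 0 → EuclideanSpace ℝ (Fin d))) = 1 := by
        rw [volume_pi, Measure.pi_univ]
        simp
      rw [this]
      simp
  | succ n ih =>
    refine (volume_pi_le_of_snoc (isCompact_shellPaths c R q₁ q₂ (n + 1)).measurableSet
      (Q := shellPaths c R q₁ q₂ n) (fun w => {y | dist (w (Fin.last n)) y ∈ Set.Icc q₁ q₂})
      (fun w => (volume_shell_eq _ _ _).le) ?_).trans ?_
    · rintro v ⟨h0, hv⟩
      exact ⟨⟨h0, fun i => hv i.castSucc⟩, hv (Fin.last n)⟩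
    · rw [pow_succ', mul_assoc]
      gcongr

theorem IsPoissonPointProcess.ae_isLocallyFiniteSet (hL : IsPoissonPointProcess L lam μ) :
    ∀ᵐ ω ∂μ, IsLocallyFiniteSet (L ω) := by
  have h : ∀ n : ℕ, ∀ᵐ ω ∂μ, (L ω ∩ Metric.closedBall 0 n).Finite := by
    intro n
    have := hL.measure_encard_mem (B := Metric.closedBall 0 n) measurableSet_closedBall
      measure_closedBall_lt_top (MeasurableSet.singleton (⊤ : ℕ∞))
    simpa [ae_iff] using this
  filter_upwards [ae_all_iff.2 h] with ω hω x r
  obtain ⟨n, hn⟩ := exists_nat_ge (dist x 0 + r)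
  refine (hω n).subset (Set.inter_subset_inter_right _ ?_)
  exact Metric.closedBall_subset_closedBall' (by linarith)

theorem IsPoissonPointProcess.ae_noIsosceles (hd : 0 < d) (hL : IsPoissonPointProcess L lam μ) :
    ∀ᵐ ω ∂μ, NoIsosceles (L ω) := by
  have : Nonempty (Fin d) := ⟨⟨0, hd⟩⟩
  have h : ∀ N : ℕ, ∀ᵐ ω ∂μ, ¬ ∃ v ∈ {v : Fin 3 → EuclideanSpace ℝ (Fin d) |
      v ∈ Metric.closedBall 0 (N : ℝ) ∧ dist (v 0) (v 1) = dist (v 0) (v 2)},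
      Function.Injective v ∧ ∀ i, v i ∈ L ω := by
    intro N
    set P := {v : Fin 3 → EuclideanSpace ℝ (Fin d) |
      v ∈ Metric.closedBall 0 (N : ℝ) ∧ dist (v 0) (v 1) = dist (v 0) (v 2)}
    have hP : IsCompact P := (isCompact_closedBall 0 (N : ℝ)).inter_right
      (isClosed_eq (by fun_prop) (by fun_prop))
    -- Given the first two points, a tie puts the third on a null sphere; the product vanishes even
    -- though the second factor is infinite.
    have hvol : volume P ≤ 0 * volume (Set.univ : Set (Fin 2 → EuclideanSpace ℝ (Fin d))) := by
      refine volume_pi_le_of_snoc hP.measurableSet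
        (fun w => Metric.sphere (w 0) (dist (w 0) (w 1))) (fun w => ?_) ?_
      · rw [Measure.addHaar_sphere]
      · rintro v ⟨-, hv⟩
        refine ⟨trivial, ?_⟩
        rw [Metric.mem_sphere, dist_comm]
        exact hv.symm
    have := hL.measure_exists_injective_le hP
    rw [zero_mul, nonpos_iff_eq_zero] at hvol
    rw [hvol, mul_zero, nonpos_iff_eq_zero] at this
    simpa only [ae_iff, not_not] using this
  filter_upwards [ae_all_iff.2 h] with ω hω x hx y hy z hz hxy hxz hyz heq
  obtain ⟨N, hN⟩ := exists_nat_ge (max ‖x‖ (max ‖y‖ ‖z‖))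
  refine hω N ⟨![x, y, z], ⟨?_, by simpa using heq⟩, ?_, ?_⟩
  · rw [mem_closedBall_zero_iff, pi_norm_le_iff_of_nonneg (Nat.cast_nonneg N)]
    intro i
    simp only [max_le_iff] at hN
    fin_cases i
    · exact hN.1
    · exact hN.2.1
    · exact hN.2.2
  · intro i j hij
    fin_cases i <;> fin_cases j <;> simp_all
  · intro i
    fin_cases i
    · exact hx
    · exact hy
    · exact hz

/-- A shell of small volume gives each point on average at most half a neighbour, so the expected
number of self-avoiding paths from a ball decays geometrically in their length. -/
theorem IsPoissonPointProcess.ae_wellFounded_frogRel (hd : 0 < d)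
    (hL : IsPoissonPointProcess L lam μ) :
    ∀ᵐ ω ∂μ, WellFounded (FrogRel (L ω)) := by
  have h : ∀ (q₁ q₂ : ℚ) (R : ℕ),
      lam * volume {y : EuclideanSpace ℝ (Fin d) | ‖y‖ ∈ Set.Icc (q₁ : ℝ) q₂} ≤ 1 / 2 →
      ∀ᵐ ω ∂μ, ∃ n, ¬ ∃ v ∈ shellPaths 0 R q₁ q₂ n, Function.Injective v ∧ ∀ i, v i ∈ L ω := by
    intro q₁ q₂ R hq
    rw [ae_iff]
    push Not
    set θ := volume {y : EuclideanSpace ℝ (Fin d) | ‖y‖ ∈ Set.Icc (q₁ : ℝ) q₂}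
    set V := volume (Metric.closedBall (0 : EuclideanSpace ℝ (Fin d)) R)
    have hV : V ≠ ⊤ := measure_closedBall_lt_top.ne
    have hle : ∀ n : ℕ, μ {ω | ∀ n, ∃ v ∈ shellPaths 0 R q₁ q₂ n, Function.Injective v ∧
        ∀ i, v i ∈ L ω} ≤ (1 / 2) ^ n * (lam * V) := by
      intro n
      calc μ {ω | ∀ n, ∃ v ∈ shellPaths 0 R q₁ q₂ n, Function.Injective v ∧ ∀ i, v i ∈ L ω}
        _ ≤ μ {ω | ∃ v ∈ shellPaths 0 (R : ℝ) q₁ q₂ n, Function.Injective v ∧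
              ∀ i, v i ∈ L ω} := measure_mono (Set.ofPred_subset_ofPred.2 fun ω hω => hω n)
        _ ≤ lam ^ (n + 1) * volume (shellPaths (0 : EuclideanSpace ℝ (Fin d)) R q₁ q₂ n) :=
            hL.measure_exists_injective_le (isCompact_shellPaths _ _ _ _ n)
        _ ≤ lam ^ (n + 1) * (θ ^ n * V) := by
            gcongr
            exact volume_shellPaths_le _ _ _ _ n
        -- Each of the `n` steps costs `lam * θ`; the remaining `lam` pays for the starting point.
        _ = (lam * θ) ^ n * (lam * V) := by ring
        _ ≤ _ := by gcongr
    have hlim : Filter.Tendsto (fun n : ℕ => (1 / 2 : ENNReal) ^ n * (lam * V)) Filter.atTop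
        (nhds (0 * (lam * V))) := by
      refine ENNReal.Tendsto.mul_const ?_ (Or.inr (by finiteness))
      exact ENNReal.tendsto_pow_atTop_nhds_zero_of_lt_one (by simp)
    rw [zero_mul] at hlim
    exact nonpos_iff_eq_zero.1 (ge_of_tendsto' hlim hle)
  have h' := ae_all_iff.2 fun q₁ => ae_all_iff.2 fun q₂ => ae_all_iff.2 fun R =>
    Filter.eventually_imp_distrib_left.2 (h q₁ q₂ R)
  filter_upwards [hL.ae_isLocallyFiniteSet, h'] with ω hfin hω
  refine wellFounded_frogRel hfin fun l => ?_
  obtain ⟨q₁, q₂, h1, h2, hq⟩ := exists_rat_shell_volume_le hd l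
    (η := 1 / 2 / lam) (by simp)
  refine ⟨q₁, q₂, h1, h2, fun x hx => ?_⟩
  obtain ⟨R, hR⟩ := exists_nat_ge ‖x‖
  obtain ⟨n, hn⟩ := hω q₁ q₂ R (by
    rw [mul_comm]
    exact ENNReal.mul_le_of_le_div hq)
  refine ⟨n, fun ⟨v, hv, hv'⟩ => hn ⟨v, ⟨?_, hv.2⟩, hv'⟩⟩
  have h0 : v 0 = x := by simpa using hv.1
  rw [h0, mem_closedBall_zero_iff]
  exact hR

end AlmostSure

/-! ## The law of the occupied dyadic cubes -/

section Occupancy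

variable {d : ℕ}

/-- The indices of the subcubes of level `k + j` of the cube of level `k` with index `a`. -/
noncomputable def dyadicChildren (j : ℕ) (a : Fin d → ℤ) : Finset (Fin d → ℤ) :=
  Fintype.piFinset fun m => Finset.Ico (a m * 2 ^ j) ((a m + 1) * 2 ^ j)

theorem mem_dyadicChildren {j : ℕ} {a b : Fin d → ℤ} :
    b ∈ dyadicChildren j a ↔ dyadicAncestor j b = a := by
  rw [dyadicChildren, Fintype.mem_piFinset, funext_iff]
  refine forall_congr' fun m => ?_
  have h : (0 : ℤ) < 2 ^ j := by positivity
  rw [Finset.mem_Ico, ← Int.le_ediv_iff_mul_le h, ← Int.ediv_lt_iff_lt_mul h, dyadicAncestor]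
  omega

/-- The cube, given by its level and its index, contains a point of `L`. -/
def occupancy (L : Set (EuclideanSpace ℝ (Fin d))) (i : ℕ × (Fin d → ℤ)) : Prop :=
  (L ∩ dyadicCube i.1 i.2).Nonempty

theorem occupancy_iff_exists_child (L : Set (EuclideanSpace ℝ (Fin d))) (k j : ℕ)
    (a : Fin d → ℤ) :
    occupancy L (k, a) ↔ ∃ b ∈ dyadicChildren j a, occupancy L (k + j, b) := by
  constructor
  · rintro ⟨x, hx, hxa⟩
    obtain rfl : dyadicIndex k x = a := hxa
    exact ⟨dyadicIndex (k + j) x, mem_dyadicChildren.2 (dyadicIndex_eq_ancestor k j x).symm,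
      x, hx, rfl⟩
  · rintro ⟨b, hb, x, hx, hxb⟩
    obtain rfl : dyadicIndex (k + j) x = b := hxb
    exact ⟨x, hx, (dyadicIndex_eq_ancestor k j x).trans (mem_dyadicChildren.1 hb)⟩

variable {Ω : Type*} [MeasurableSpace Ω] {μ : Measure Ω} {lam : ℝ≥0}
  {L L' : Ω → Set (EuclideanSpace ℝ (Fin d))}

theorem IsPoissonPointProcess.aemeasurable_occupancy (hL : IsPoissonPointProcess L lam μ) :
    AEMeasurable (fun ω => occupancy (L ω)) μ := by
  refine aemeasurable_pi_iff.2 fun i => ?_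
  have h := (hL.hasLaw_count _ (measurableSet_dyadicCube i.1 i.2)
    (volume_dyadicCube_lt_top i.1 i.2)).aemeasurable
  have h2 : Measurable fun n : ℕ∞ => n ≠ 0 :=
    measurableSet_setOfPred.1 (MeasurableSet.singleton 0).compl
  refine (h2.comp_aemeasurable h).congr (Filter.Eventually.of_forall fun ω => ?_)
  simp [occupancy, Set.nonempty_iff_ne_empty]

theorem IsPoissonPointProcess.map_count_eq [IsProbabilityMeasure μ]
    (hL : IsPoissonPointProcess L lam μ)
    {n : ℕ} {B : Fin n → Set (EuclideanSpace ℝ (Fin d))} (hB : ∀ i, MeasurableSet (B i))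
    (hv : ∀ i, volume (B i) < ⊤) (hd : Pairwise fun i j => Disjoint (B i) (B j)) :
    μ.map (fun ω i => (L ω ∩ B i).encard) = Measure.pi fun i =>
      (poissonMeasure (lam * (volume (B i)).toNNReal)).map (Nat.cast : ℕ → ℕ∞) := by
  have h := fun i => hL.hasLaw_count (B i) (hB i) (hv i)
  rw [(iIndepFun_iff_map_fun_eq_pi_map fun i => (h i).aemeasurable).1
    (hL.iIndepFun_count n B hB hv hd)]
  simp only [(h _).map_eq]

/-- Poisson processes of the same intensity have the same law of the occupied cubes. -/
theorem IsPoissonPointProcess.map_occupancy_eq [IsProbabilityMeasure μ]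
    (hL : IsPoissonPointProcess L lam μ) (hL' : IsPoissonPointProcess L' lam μ) :
    μ.map (fun ω => occupancy (L ω)) = μ.map (fun ω => occupancy (L' ω)) := by
  have hfin : ∀ I : Finset (ℕ × (Fin d → ℤ)),
      (μ.map (fun ω => occupancy (L' ω))).map I.restrict =
        (μ.map (fun ω => occupancy (L ω))).map I.restrict := by
    intro I
    classical
    -- Refine all cubes of `I` to their finest level `K`. The cubes indexed by `J` are then
    -- disjoint, their counts have the same joint law for both processes, and `ρ` reads the
    -- occupancies off these counts.
    let K := I.sup Prod.fst
    let J := I.biUnion fun i => dyadicChildren (K - i.1) i.2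
    let B : Fin J.card → Set (EuclideanSpace ℝ (Fin d)) :=
      fun n => dyadicCube K (J.equivFin.symm n)
    have hB : ∀ n, MeasurableSet (B n) := fun n => measurableSet_dyadicCube _ _
    have hv : ∀ n, volume (B n) < ⊤ := fun n => volume_dyadicCube_lt_top _ _
    have hd : Pairwise fun n n' => Disjoint (B n) (B n') := fun n n' hne =>
      disjoint_dyadicCube fun h => hne (J.equivFin.symm.injective (Subtype.ext h))
    let ρ : (Fin J.card → ℕ∞) → I → Prop := fun c i =>
      ∃ n, (J.equivFin.symm n : Fin d → ℤ) ∈ dyadicChildren (K - i.1.1) i.1.2 ∧ c n ≠ 0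
    have hρ : Measurable ρ := by
      refine measurable_pi_lambda _ fun i => Measurable.exists fun n =>
        measurable_const.and ?_
      have h0 : Measurable fun c : ℕ∞ => c ≠ 0 :=
        measurableSet_setOfPred.1 (MeasurableSet.singleton 0).compl
      exact h0.comp (measurable_pi_apply n)
    have key : ∀ {L : Ω → Set (EuclideanSpace ℝ (Fin d))}, IsPoissonPointProcess L lam μ →
        (μ.map (fun ω => occupancy (L ω))).map I.restrict =
          (Measure.pi fun i => (poissonMeasure (lam * (volume (B i)).toNNReal)).map
            (Nat.cast : ℕ → ℕ∞)).map ρ := by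
      intro L hL
      rw [← hL.map_count_eq hB hv hd, AEMeasurable.map_map_of_aemeasurable
        (Finset.measurable_restrict I).aemeasurable hL.aemeasurable_occupancy,
        AEMeasurable.map_map_of_aemeasurable hρ.aemeasurable (aemeasurable_pi_iff.2 fun i =>
          (hL.hasLaw_count (B i) (hB i) (hv i)).aemeasurable)]
      congr 1
      funext ω i
      obtain ⟨⟨k, a⟩, hi⟩ := i
      have hk : k ≤ K := Finset.le_sup (f := Prod.fst) hi
      refine propext ?_
      change occupancy (L ω) (k, a) ↔ ∃ n, (J.equivFin.symm n : Fin d → ℤ) ∈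
        dyadicChildren (K - k) a ∧ (L ω ∩ B n).encard ≠ 0
      rw [occupancy_iff_exists_child (L ω) k (K - k) a, Nat.add_sub_cancel' hk]
      constructor
      · rintro ⟨b, hb, hocc⟩
        have hbJ : b ∈ J := Finset.mem_biUnion.2 ⟨(k, a), hi, hb⟩
        refine ⟨J.equivFin ⟨b, hbJ⟩, by simpa using hb, ?_⟩
        simpa [B, ← Set.nonempty_iff_ne_empty, occupancy] using hocc
      · rintro ⟨n, hn, hne⟩
        refine ⟨_, hn, ?_⟩
        simpa [B, ← Set.nonempty_iff_ne_empty, occupancy] using hne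
    rw [key hL, key hL']
  -- Finite-dimensional marginals determine a law on the product.
  have : IsProbabilityMeasure (μ.map (fun ω => occupancy (L ω))) :=
    Measure.isProbabilityMeasure_map hL.aemeasurable_occupancy
  have : ∀ I : Finset (ℕ × (Fin d → ℤ)), IsFiniteMeasure
    ((μ.map (fun ω => occupancy (L ω))).map I.restrict) := fun I => inferInstance
  exact IsProjectiveLimit.unique
    (P := fun I => (μ.map (fun ω => occupancy (L ω))).map I.restrict) (fun I => rfl) hfin

end Occupancy

/-! ## Recovering the points from the occupied cubes -/

section Recovery

variable {d : ℕ}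

/-- The lower corner of a dyadic cube. -/
noncomputable def dyadicCorner (k : ℕ) (a : Fin d → ℤ) : EuclideanSpace ℝ (Fin d) :=
  WithLp.toLp 2 fun m => (a m : ℝ) / 2 ^ k

open Classical in
/-- The sum of the lower corners of the occupied subcubes of level `i.1 + j`. -/
noncomputable def occupiedCorner (o : ℕ × (Fin d → ℤ) → Prop) (i : ℕ × (Fin d → ℤ)) (j : ℕ) :
    EuclideanSpace ℝ (Fin d) :=
  ∑ b ∈ dyadicChildren j i.2, if o (i.1 + j, b) then dyadicCorner (i.1 + j) b else 0

/-- The limit of the lower corners of the occupied subcubes. -/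
noncomputable def occupiedPoint (o : ℕ × (Fin d → ℤ) → Prop) (i : ℕ × (Fin d → ℤ)) :
    EuclideanSpace ℝ (Fin d) :=
  WithLp.toLp 2 fun m => Filter.limsup (fun j => occupiedCorner o i j m) Filter.atTop

/-- The cube is occupied, and at each further level it has at most one occupied subcube. -/
def IsolatedCube (o : ℕ × (Fin d → ℤ) → Prop) (i : ℕ × (Fin d → ℤ)) : Prop :=
  o i ∧ ∀ j, ∀ b ∈ dyadicChildren j i.2, ∀ b' ∈ dyadicChildren j i.2,
    o (i.1 + j, b) → o (i.1 + j, b') → b = b'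

/-- The points in isolated cubes. -/
def occupiedPoints (o : ℕ × (Fin d → ℤ) → Prop) : Set (EuclideanSpace ℝ (Fin d)) :=
  {x | ∃ i, IsolatedCube o i ∧ occupiedPoint o i = x}

theorem measurable_occupiedPoint (i : ℕ × (Fin d → ℤ)) :
    Measurable fun o : ℕ × (Fin d → ℤ) → Prop => occupiedPoint o i := by
  classical
  have h : ∀ j, Measurable fun o : ℕ × (Fin d → ℤ) → Prop => occupiedCorner o i j := by
    intro j
    refine Finset.measurable_fun_sum _ fun b _ => Measurable.ite ?_ measurable_const
      measurable_const
    exact measurableSet_setOfPred.2 (measurable_pi_apply _)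
  refine (PiLp.volume_preserving_toLp (Fin d)).measurable.comp
    (measurable_pi_lambda _ fun m => ?_)
  refine Measurable.limsup fun j => ?_
  have hm : Measurable fun x : EuclideanSpace ℝ (Fin d) => x m := by fun_prop
  exact hm.comp (h j)

theorem measurable_isolatedCube (i : ℕ × (Fin d → ℤ)) :
    Measurable fun o : ℕ × (Fin d → ℤ) → Prop => IsolatedCube o i := by
  refine (measurable_pi_apply i).and (Measurable.forall fun j => Measurable.forall fun b =>
    Measurable.forall fun _ => Measurable.forall fun b' => Measurable.forall fun _ => ?_)
  exact (measurable_pi_apply _).imp ((measurable_pi_apply _).imp measurable_const)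

theorem occupiedPoint_eq {L : Set (EuclideanSpace ℝ (Fin d))}
    {i : ℕ × (Fin d → ℤ)} (h : IsolatedCube (occupancy L) i) {x : EuclideanSpace ℝ (Fin d)}
    (hx : x ∈ L ∩ dyadicCube i.1 i.2) : occupiedPoint (occupancy L) i = x := by
  have hc : ∀ j, occupiedCorner (occupancy L) i j =
      dyadicCorner (i.1 + j) (dyadicIndex (i.1 + j) x) := by
    intro j
    have hmem : dyadicIndex (i.1 + j) x ∈ dyadicChildren j i.2 :=
      mem_dyadicChildren.2 ((dyadicIndex_eq_ancestor _ _ _).symm.trans hx.2)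
    have hocc : occupancy L (i.1 + j, dyadicIndex (i.1 + j) x) := ⟨x, hx.1, rfl⟩
    rw [occupiedCorner, Finset.sum_eq_single_of_mem _ hmem, if_pos hocc]
    intro b hb hne
    rw [if_neg]
    exact fun hb' => hne (h.2 j b hb _ hmem hb' hocc)
  ext m
  refine Filter.Tendsto.limsup_eq ?_
  -- The corner of the cube containing `x` is squeezed between this sequence and `x m`.
  have hlim : Filter.Tendsto (fun j : ℕ => x m - (1 / 2 : ℝ) ^ (i.1 + j)) Filter.atTop
      (nhds (x m)) := by
    have := (tendsto_pow_atTop_nhds_zero_of_lt_one (r := (1 / 2 : ℝ)) (by norm_num)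
      (by norm_num)).comp (Filter.tendsto_add_atTop_nat i.1)
    simpa [Function.comp_def, add_comm] using this.const_sub (x m)
  refine tendsto_of_tendsto_of_tendsto_of_le_of_le hlim tendsto_const_nhds (fun j => ?_)
    fun j => ?_
  · have := (mem_dyadicCube_iff_Ico.1 (mem_dyadicCube_iff.2
      (rfl : dyadicIndex (i.1 + j) x = _)) m).2
    rw [add_div] at this
    simp only [hc, dyadicCorner, one_div, inv_pow] at this ⊢
    linarith
  · have := (mem_dyadicCube_iff_Ico.1 (mem_dyadicCube_iff.2
      (rfl : dyadicIndex (i.1 + j) x = _)) m).1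
    simpa only [hc, dyadicCorner] using this

/-- By local finiteness each point is alone in a sufficiently small cube, which is then isolated.
Conversely, the occupied subcubes of an isolated cube shrink to a point of `L` in it. -/
theorem occupiedPoints_occupancy {L : Set (EuclideanSpace ℝ (Fin d))}
    (hfin : IsLocallyFiniteSet L) : occupiedPoints (occupancy L) = L := by
  ext x
  constructor
  · rintro ⟨i, hi, rfl⟩
    obtain ⟨x, hx⟩ := hi.1
    rw [occupiedPoint_eq hi hx]
    exact hx.1
  · intro hx
    -- The radius `√d` bounds the diameter of cubes of every level, so only these finitely many
    -- points can share a cube with `x`.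
    have hev : ∀ᶠ k in Filter.atTop, ∀ y ∈ L ∩ Metric.closedBall x (√d),
        y ≠ x → dyadicIndex k y ≠ dyadicIndex k x := by
      rw [Filter.eventually_all_finite (hfin x (√d))]
      intro y _
      by_cases hne : y = x
      · simp [hne]
      · exact (eventually_dyadicIndex_ne hne).mono fun k hk _ => hk
    obtain ⟨k, hk⟩ := hev.exists
    have huniq : ∀ y ∈ L, dyadicIndex k y = dyadicIndex k x → y = x := by
      intro y hy heq
      by_contra hne
      refine hk y ⟨hy, (dist_le_of_dyadicIndex_eq heq).trans ?_⟩ hne heq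
      exact mul_le_of_le_one_right (Real.sqrt_nonneg _) (pow_le_one₀ (by norm_num) (by norm_num))
    have hiso : IsolatedCube (occupancy L) (k, dyadicIndex k x) := by
      refine ⟨⟨x, hx, rfl⟩, fun j => ?_⟩
      have : ∀ b ∈ dyadicChildren j (dyadicIndex k x), occupancy L (k + j, b) →
          b = dyadicIndex (k + j) x := by
        rintro b hb ⟨y, hy, hyb⟩
        obtain rfl : dyadicIndex (k + j) y = b := hyb
        rw [huniq y hy ((dyadicIndex_eq_ancestor k j y).trans (mem_dyadicChildren.1 hb))]
      exact fun b hb b' hb' ho ho' => (this b hb ho).trans (this b' hb' ho').symm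
    exact ⟨_, hiso, occupiedPoint_eq hiso ⟨hx, rfl⟩⟩

/-- Indexing the points by cubes turns the quantifier over a random set into a countable one, so
each stage is measurable. -/
theorem measurable_greedyPair_occupiedPoints (n : ℕ) (i l : ℕ × (Fin d → ℤ)) :
    Measurable fun o : ℕ × (Fin d → ℤ) → Prop =>
      greedyPair (occupiedPoints o) n (occupiedPoint o i) (occupiedPoint o l) := by
  induction n generalizing i l with
  | zero => exact measurable_const
  | succ n ih =>
    have hX := fun i => measurable_occupiedPoint (d := d) i
    have hne : ∀ a b : ℕ × (Fin d → ℤ), Measurable fun o : ℕ × (Fin d → ℤ) → Prop =>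
        occupiedPoint o a ≠ occupiedPoint o b := fun a b =>
      (measurableSet_setOfPred.1 (measurableSet_eq_fun (hX a) (hX b))).not
    have hlt : ∀ a b : ℕ × (Fin d → ℤ), Measurable fun o : ℕ × (Fin d → ℤ) → Prop =>
        dist (occupiedPoint o a) (occupiedPoint o b) <
          dist (occupiedPoint o i) (occupiedPoint o l) := fun a b =>
      measurableSet_setOfPred.1 (measurableSet_lt ((hX a).dist (hX b)) ((hX i).dist (hX l)))
    have : ∀ o : ℕ × (Fin d → ℤ) → Prop,
        greedyPair (occupiedPoints o) (n + 1) (occupiedPoint o i) (occupiedPoint o l) ↔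
        ∀ c, IsolatedCube o c →
          (occupiedPoint o c ≠ occupiedPoint o i →
            dist (occupiedPoint o i) (occupiedPoint o c) <
              dist (occupiedPoint o i) (occupiedPoint o l) →
            ¬ greedyPair (occupiedPoints o) n (occupiedPoint o i) (occupiedPoint o c)) ∧
          (occupiedPoint o c ≠ occupiedPoint o l →
            dist (occupiedPoint o l) (occupiedPoint o c) <
              dist (occupiedPoint o i) (occupiedPoint o l) →
            ¬ greedyPair (occupiedPoints o) n (occupiedPoint o l) (occupiedPoint o c)) := by
      intro o
      constructor
      · exact fun h c hc => h _ ⟨c, hc, rfl⟩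
      · rintro h _ ⟨c, hc, rfl⟩
        exact h c hc
    simp only [this]
    exact Measurable.forall fun c => (measurable_isolatedCube c).imp
      (((hne c i).imp ((hlt i c).imp (ih i c).not)).and
        ((hne c l).imp ((hlt l c).imp (ih l c).not)))

theorem measurableSet_exists_greedyUnmatched {Q : Set (EuclideanSpace ℝ (Fin d))}
    (hQ : MeasurableSet Q) :
    MeasurableSet {o : ℕ × (Fin d → ℤ) → Prop |
      ∃ x ∈ Q, GreedyUnmatched (occupiedPoints o) x} := by
  have : ∀ o : ℕ × (Fin d → ℤ) → Prop, (∃ x ∈ Q, GreedyUnmatched (occupiedPoints o) x) ↔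
      ∃ i, IsolatedCube o i ∧ occupiedPoint o i ∈ Q ∧ ∀ l, IsolatedCube o l →
        occupiedPoint o l ≠ occupiedPoint o i → ¬ ∃ N, ∀ n ≥ N,
          greedyPair (occupiedPoints o) n (occupiedPoint o i) (occupiedPoint o l) := by
    intro o
    constructor
    · rintro ⟨_, hQ, ⟨i, hi, rfl⟩, h⟩
      exact ⟨i, hi, hQ, fun l hl => h _ ⟨l, hl, rfl⟩⟩
    · rintro ⟨i, hi, hQ, h⟩
      refine ⟨_, hQ, ⟨i, hi, rfl⟩, ?_⟩
      rintro _ ⟨l, hl, rfl⟩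
      exact h l hl
  simp only [this]
  refine measurableSet_setOfPred.2 (Measurable.exists fun i => (measurable_isolatedCube i).and
    (Measurable.and ?_ (Measurable.forall fun l => (measurable_isolatedCube l).imp
      (Measurable.imp ?_ (Measurable.exists fun N => Measurable.forall fun n =>
        Measurable.forall fun _ => measurable_greedyPair_occupiedPoints n i l).not))))
  · exact measurableSet_setOfPred.1 (measurable_occupiedPoint i hQ)
  · exact (measurableSet_setOfPred.1
      (measurableSet_eq_fun (measurable_occupiedPoint l) (measurable_occupiedPoint i))).not

end Recovery

/-! ## Translation invariance -/

section Translation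

theorem greedyPair_image_add {E : Type*} [NormedAddCommGroup E] (L : Set E) (v : E) (n : ℕ)
    (x y : E) : greedyPair ((· + v) '' L) n (x + v) (y + v) ↔ greedyPair L n x y := by
  induction n generalizing x y with
  | zero => exact Iff.rfl
  | succ n ih =>
    simp only [greedyPair, Set.forall_mem_image, ih, ne_eq, add_left_inj, dist_add_right]

theorem greedyUnmatched_image_add {E : Type*} [NormedAddCommGroup E] (L : Set E) (v x : E) :
    GreedyUnmatched ((· + v) '' L) (x + v) ↔ GreedyUnmatched L x := by
  simp only [GreedyUnmatched, GreedyMatched, greedyPair_image_add, Set.forall_mem_image, ne_eq,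
    add_left_inj, (add_left_injective v).mem_set_image]

variable {d : ℕ} {Ω : Type*} [MeasurableSpace Ω] {μ : Measure Ω} {lam : ℝ≥0}
  {L : Ω → Set (EuclideanSpace ℝ (Fin d))}

theorem IsPoissonPointProcess.image_add (hL : IsPoissonPointProcess L lam μ)
    (v : EuclideanSpace ℝ (Fin d)) :
    IsPoissonPointProcess (fun ω => (· + v) '' L ω) lam μ := by
  have hm : Measurable fun x : EuclideanSpace ℝ (Fin d) => x + v := measurable_add_const v
  have hc : ∀ (B : Set (EuclideanSpace ℝ (Fin d))) (ω : Ω),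
      ((· + v) '' L ω ∩ B).encard = (L ω ∩ (· + v) ⁻¹' B).encard := fun B ω => by
    rw [← Set.image_inter_preimage, (add_left_injective v).encard_image]
  have hvol : ∀ B : Set (EuclideanSpace ℝ (Fin d)), volume ((· + v) ⁻¹' B) = volume B :=
    fun B => measure_preimage_add_right volume v B
  constructor
  · intro B hB hv
    simp only [hc]
    rw [← hvol B]
    exact hL.hasLaw_count _ (hm hB) (by rwa [hvol])
  · intro n B hB hv hd
    simp only [hc]
    exact hL.iIndepFun_count n _ (fun i => hm (hB i)) (fun i => by rw [hvol]; exact hv i)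
      fun i j hij => (hd hij).preimage _

theorem dyadicIndex_zero_add_corner (a : Fin d → ℤ) (x : EuclideanSpace ℝ (Fin d)) :
    dyadicIndex 0 (x + dyadicCorner 0 a) = dyadicIndex 0 x + a := by
  funext m
  simp [dyadicIndex, dyadicCorner]

/-- By translation invariance, an unmatched point, if there is one, would be uniformly
distributed over infinitely many cubes of the same size; so there is none. -/
theorem IsPoissonPointProcess.ae_not_greedyUnmatched [IsProbabilityMeasure μ] (hd : 0 < d)
    (hL : IsPoissonPointProcess L lam μ) : ∀ᵐ ω ∂μ, ∀ x, ¬ GreedyUnmatched (L ω) x := by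
  have : Nonempty (Fin d) := ⟨⟨0, hd⟩⟩
  let Q : Set (EuclideanSpace ℝ (Fin d)) := dyadicCube 0 0
  let A : Set (ℕ × (Fin d → ℤ) → Prop) := {o | ∃ x ∈ Q, GreedyUnmatched (occupiedPoints o) x}
  have hA : MeasurableSet A := measurableSet_exists_greedyUnmatched (measurableSet_dyadicCube 0 0)
  let T : (Fin d → ℤ) → Ω → Set (EuclideanSpace ℝ (Fin d)) := fun a ω =>
    (· + dyadicCorner 0 a) '' L ω
  have hT : ∀ a, IsPoissonPointProcess (T a) lam μ := fun a => hL.image_add _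
  let U : (Fin d → ℤ) → Set Ω := fun a => (fun ω => occupancy (T a ω)) ⁻¹' A
  have hU : ∀ a, ∀ᵐ ω ∂μ, ω ∈ U a ↔ ∃ x, dyadicIndex 0 x = -a ∧ GreedyUnmatched (L ω) x := by
    intro a
    filter_upwards [(hT a).ae_isLocallyFiniteSet] with ω hω
    change (∃ x ∈ Q, GreedyUnmatched (occupiedPoints (occupancy (T a ω))) x) ↔ _
    rw [occupiedPoints_occupancy hω]
    -- Shifting by `a` carries the cube `-a` onto `Q`, which explains the sign.
    have hshift : ∀ x, x + dyadicCorner 0 a ∈ Q ↔ dyadicIndex 0 x = -a := fun x => by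
      rw [mem_dyadicCube_iff, dyadicIndex_zero_add_corner, add_eq_zero_iff_eq_neg]
    constructor
    · rintro ⟨x, hxQ, hx⟩
      obtain ⟨y, rfl⟩ : ∃ y, x = y + dyadicCorner 0 a := ⟨x - dyadicCorner 0 a, by simp⟩
      exact ⟨y, (hshift y).1 hxQ, (greedyUnmatched_image_add _ _ _).1 hx⟩
    · rintro ⟨x, hxQ, hx⟩
      exact ⟨_, (hshift x).2 hxQ, (greedyUnmatched_image_add _ _ _).2 hx⟩
  have hconst : ∀ a, μ (U a) = μ.map (fun ω => occupancy (L ω)) A := by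
    intro a
    rw [← (hT a).map_occupancy_eq hL,
      Measure.map_apply_of_aemeasurable (hT a).aemeasurable_occupancy hA]
  have hunique : ∀ᵐ ω ∂μ, ∀ x y, GreedyUnmatched (L ω) x → GreedyUnmatched (L ω) y → x = y := by
    filter_upwards [hL.ae_isLocallyFiniteSet, hL.ae_noIsosceles hd, hL.ae_wellFounded_frogRel hd]
      with ω hfin hiso hwf x y hx hy
    obtain ⟨M, hM⟩ := exists_isFrogKernel hwf
    have hx' := (greedyUnmatched_iff hfin hwf hM (x := ⟨x, hx.1⟩)).1 hx
    have hy' := (greedyUnmatched_iff hfin hwf hM (x := ⟨y, hy.1⟩)).1 hy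
    exact congrArg Subtype.val
      (((isStableFrogMatching_iff_isFrogKernel hiso).2 hM).unmatched_unique hx' hy')
  -- Only almost disjoint, since the uniqueness of an unmatched point and the description of `U`
  -- hold almost surely.
  have hdisj : Pairwise (Function.onFun (AEDisjoint μ) U) := by
    intro a b hab
    have : ∀ᵐ ω ∂μ, ω ∉ U a ∩ U b := by
      filter_upwards [hU a, hU b, hunique] with ω ha hb hω hmem
      obtain ⟨x, hx, hx'⟩ := ha.1 hmem.1
      obtain ⟨y, hy, hy'⟩ := hb.1 hmem.2
      rw [hω x y hx' hy'] at hx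
      exact hab (neg_injective (hx.symm.trans hy))
    exact measure_eq_zero_iff_ae_notMem.2 this
  -- Infinitely many almost disjoint events of equal positive probability would have infinite total
  -- mass; the index set is infinite because `d` is positive.
  have hzero : μ.map (fun ω => occupancy (L ω)) A = 0 := by
    by_contra hne
    have h1 := measure_iUnion₀ hdisj fun a =>
      (hT a).aemeasurable_occupancy.nullMeasurable hA
    simp only [hconst] at h1
    rw [ENNReal.tsum_const_eq_top_of_ne_zero hne] at h1
    exact measure_ne_top μ _ h1
  have hnull : ∀ᵐ ω ∂μ, ∀ a, ω ∉ U a :=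
    ae_all_iff.2 fun a => measure_eq_zero_iff_ae_notMem.1 ((hconst a).trans hzero)
  filter_upwards [ae_all_iff.2 hU, hnull] with ω hω hω' x hx
  exact hω' (-dyadicIndex 0 x) ((hω _).2 ⟨x, by simp, hx⟩)

/-- There is no Poisson process on a one-point space. -/
theorem IsPoissonPointProcess.dim_pos (hlam : 0 < lam) (hL : IsPoissonPointProcess L lam μ) :
    0 < d := by
  by_contra hd
  obtain rfl : d = 0 := by omega
  have hv : volume (Set.univ : Set (EuclideanSpace ℝ (Fin 0))) = 1 := by
    have h := volume_dyadicCube (d := 0) 0 0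
    have h' : (dyadicCube 0 0 : Set (EuclideanSpace ℝ (Fin 0))) = Set.univ :=
      Set.eq_univ_of_forall fun x => Subsingleton.elim _ _
    rw [h'] at h
    simpa using h
  -- Two points have positive Poisson probability, but the space has only one.
  have h := hL.measure_encard_mem MeasurableSet.univ (hv.trans_lt ENNReal.one_lt_top)
    (MeasurableSet.singleton (2 : ℕ∞))
  have h0 : {ω | (L ω ∩ Set.univ).encard ∈ ({2} : Set ℕ∞)} = ∅ := by
    refine Set.eq_empty_of_forall_notMem fun ω hω => ?_
    have h1 : (L ω ∩ Set.univ).encard ≤ 1 :=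
      Set.encard_le_one_iff.2 fun x y _ _ => Subsingleton.elim x y
    have h2 : (L ω ∩ Set.univ).encard = 2 := hω
    rw [h2] at h1
    exact absurd h1 (by decide)
  have h2 : {n : ℕ | (n : ℕ∞) ∈ ({2} : Set ℕ∞)} = {2} := by
    ext n
    simp only [Set.mem_ofPred_eq, Set.mem_singleton_iff]
    norm_cast
  rw [h0, measure_empty, hv, h2] at h
  have := poissonMeasure_real_singleton_pos 2 hlam
  rw [ENNReal.toNNReal_one, mul_one] at h
  rw [measureReal_def, ← h] at this
  simp at this

end Translation

theorem mainTheorem2 (d : ℕ) {Ω : Type*} [MeasurableSpace Ω] (μ : Measure Ω)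
    [IsProbabilityMeasure μ] (lam : ℝ≥0) (hlam : 0 < lam)
    (L : Ω → Set (EuclideanSpace ℝ (Fin d))) (hL : IsPoissonPointProcess L lam μ) :
    ∀ᵐ ω ∂μ, FriendlyFrogsWinForBob (L ω) ∧
      (∃! M, IsStableFrogMatching (L ω) M) ∧
      (∀ M, IsStableFrogMatching (L ω) M → IsPerfectFrogMatching (L ω) M) := by
  have hd := hL.dim_pos hlam
  filter_upwards [hL.ae_isLocallyFiniteSet, hL.ae_noIsosceles hd, hL.ae_wellFounded_frogRel hd,
    hL.ae_not_greedyUnmatched hd] with ω hfin hiso hwf hun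
  have hperf : ∀ M, IsFrogKernel (L ω) M → ∀ x : L ω, ∃ y, s(x, y) ∈ M := by
    intro M hM x
    have := mt (greedyUnmatched_iff hfin hwf hM (x := x)).2 (hun x)
    push Not at this
    exact this
  obtain ⟨M, hM⟩ := exists_isFrogKernel hwf
  refine ⟨friendlyFrogsWinForBob_of_isFrogKernel hwf hM (hperf M hM),
    existsUnique_isStableFrogMatching hiso hwf, fun M' hM' => ?_⟩
  exact hM'.1.isPerfect (hperf M' ((isStableFrogMatching_iff_isFrogKernel hiso).1 hM'))
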